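/- Let $L,T>0$, $\sigma\in\mathbf R$, and let $(u,p)$, with $u:[0,T]\times\mathbf R^2\to\mathbf R^2$ and $p$ scalar, be a classical solution of the two-dimensional incompressible Navier--Stokes problem with negative direction of time $$\frac{\partial u}{\partial t}+\frac{\sigma^2}{2}\Delta u-(u,\nabla)u-\nabla p+f=0,\quad 0\le t<T,\qquad \mathop{\rm div}u=0,\qquad u(T,x)=\varphi(x),$$ where $u$, $p$, $f$ are periodic in space with period $L$ in both coordinate directions, $u$ is $C^3$ on $[0,T]\times\mathbf R^2$ (up to the boundary in time), and $p(t,\cdot)$ is $C^2$ and $f(t,\cdot)$ is $C^1$ for each $t\in[0,T)$. For a planar vector field $v$ write $\mathop{\rm curl}v=\frac{\partial v^2}{\partial x^1}-\frac{\partial v^1}{\partial x^2}$, and let $\omega(t,\cdot)=\mathop{\rm curl}u(t,\cdot)$ be the vorticity and $g(t,\cdot)=\mathop{\rm curl}f(t,\cdot)$. Then there is a constant $K>0$ such that the following holds for every integer $N\ge1$ and every $k\in\{0,\dots,N-1\}$. Put $h=T/N$, $t_k=kh$, and let $\hat u(x)=u(t_{k+1},x)$ be the velocity frozen on the $k$-th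 time interval. Let $\tilde\omega$ be a classical solution on $[t_k,t_{k+1}]$, periodic in space with period $L$ in both coordinate directions, of $$\frac{\partial\tilde\omega}{\partial t}-\hat u^1(x)\frac{\partial\tilde\omega}{\partial x^1}-\hat u^2(x)\frac{\partial\tilde\omega}{\partial x^2}+\frac{\sigma^2}{2}\Delta\tilde\omega+g(t,x)=0,\quad t_k\le t<t_{k+1},\qquad \tilde\omega(t_{k+1},x)=\omega(t_{k+1},x),$$ that is, $\tilde\omega$ is continuous on $[t_k,t_{k+1}]\times\mathbf R^2$ and, for $t\in[t_k,t_{k+1})$, differentiable in $t$ (one-sidedly at $t_k$) and $C^2$ in $x$. Then the one-step error $\delta_\omega(t,x)=\omega(t,x)-\tilde\omega(t,x)$ satisfies $$|\delta_\omega(t,x)|\le K h^2,\qquad t_k\le t\le t_{k+1},\ x\in\mathbf R^2 .$$ The constant $K$ does not depend on $N$, $k$, $\tilde\omega$, $t$ or $x$. -/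

import Mathlib

open Set Laplacian Gradient

namespace NSVorticity

/-- The plane `ℝ²` with its Euclidean norm. -/
abbrev Plane : Type := EuclideanSpace ℝ (Fin 2)

/-- The canonical basis vector `e i` of the plane. -/
noncomputable def e (i : Fin 2) : Plane := EuclideanSpace.single i 1

/-- The function `φ` on the plane is periodic with period `L` in both coordinate directions. -/
def SpacePeriodic {α : Type*} (L : ℝ) (φ : Plane → α) : Prop :=
  ∀ (i : Fin 2) (x : Plane), φ (x + L • e i) = φ x

/-- The divergence `∂v¹/∂x¹ + ∂v²/∂x²` of a planar vector field. -/
noncomputable def divergence (v : Plane → Plane) (x : Plane) : ℝ :=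
  ∑ i : Fin 2, fderiv ℝ v x (e i) i

/-- The scalar curl `∂v²/∂x¹ - ∂v¹/∂x²` of a planar vector field. -/
noncomputable def curl (v : Plane → Plane) (x : Plane) : ℝ :=
  fderiv ℝ v x (e 0) 1 - fderiv ℝ v x (e 1) 0

/-- `(u, p)` is a sufficiently smooth classical solution on `[0, T] × ℝ²` of the two-dimensional
incompressible Navier-Stokes problem with negative direction of time, space period `L`, force `f`
and terminal velocity `φ`. The term `fderiv ℝ (u t) x (u t x)` is `(u, ∇) u`. -/
structure IsNavierStokesSolution (L σ T : ℝ) (f : ℝ → Plane → Plane) (φ : Plane → Plane)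
    (u : ℝ → Plane → Plane) (p : ℝ → Plane → ℝ) : Prop where
  smooth_velocity :
    ContDiffOn ℝ 3 (fun z : ℝ × Plane => u z.1 z.2) (Icc 0 T ×ˢ (univ : Set Plane))
  smooth_pressure : ∀ t ∈ Ico 0 T, ContDiff ℝ 2 (p t)
  smooth_force : ∀ t ∈ Ico 0 T, ContDiff ℝ 1 (f t)
  periodic_velocity : ∀ t ∈ Icc 0 T, SpacePeriodic L (u t)
  periodic_pressure : ∀ t ∈ Ico 0 T, SpacePeriodic L (p t)
  periodic_force : ∀ t ∈ Ico 0 T, SpacePeriodic L (f t)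
  momentum : ∀ t ∈ Ico 0 T, ∀ x : Plane,
    derivWithin (fun s => u s x) (Icc 0 T) t + (σ ^ 2 / 2) • (Δ (u t)) x
      - fderiv ℝ (u t) x (u t x) - (∇ (p t)) x + f t x = 0
  incompressible : ∀ t ∈ Icc 0 T, ∀ x : Plane, divergence (u t) x = 0
  terminal : ∀ x : Plane, u T x = φ x

/-- `w` is a classical space-periodic solution on `[a, b] × ℝ²` of the linear vorticity equation
`∂w/∂t - (v, ∇) w + (σ² / 2) Δ w + g = 0` on `[a, b)` with time-independent velocity `v`
and terminal value `w(b, ·) = w₁`. -/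
structure IsFrozenVorticitySolution (L σ a b : ℝ) (v : Plane → Plane) (g : ℝ → Plane → ℝ)
    (w₁ : Plane → ℝ) (w : ℝ → Plane → ℝ) : Prop where
  continuous_upto :
    ContinuousOn (fun z : ℝ × Plane => w z.1 z.2) (Icc a b ×ˢ (univ : Set Plane))
  smooth_space : ∀ t ∈ Ico a b, ContDiff ℝ 2 (w t)
  smooth_time : ∀ t ∈ Ico a b, ∀ x : Plane,
    DifferentiableWithinAt ℝ (fun s => w s x) (Icc a b) t
  periodic : ∀ t ∈ Icc a b, SpacePeriodic L (w t)
  equation : ∀ t ∈ Ico a b, ∀ x : Plane,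
    derivWithin (fun s => w s x) (Icc a b) t - fderiv ℝ (w t) x (v x)
      + σ ^ 2 / 2 * (Δ (w t)) x + g t x = 0
  terminal : ∀ x : Plane, w b x = w₁ x

/-- The step `h = T / N` of the uniform partition of `[0, T]` into `N` intervals. -/
noncomputable def step (T : ℝ) (N : ℕ) : ℝ := T / N

/-- The node `t_k = k h` of the uniform partition of `[0, T]` into `N` intervals. -/
noncomputable def node (T : ℝ) (N k : ℕ) : ℝ := k * step T N

end NSVorticity

/-! Taking the curl of the momentum equation removes the pressure and, since `div u = 0`, gives a
scalar transport-diffusion equation for the vorticity ω. Subtracting the frozen equation cancels the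
force, so the error δ has zero terminal value and solves the same linear equation with velocity û,
with residual `((u - û), ∇) ω` in place of the force. That residual is O(h): u is Lipschitz in time
and ∇ω is bounded, uniformly by periodicity and compactness. The maximum principle
(`abs_le_mul_of_abs_residual_lt`) integrates it over a time at most h, giving O(h²). The constants
come from u on all of `[0, T]`, hence do not depend on the partition. -/

namespace NSVorticity

/-! ### Periodicity and compactness -/

/-- Every point is congruent, modulo the period lattice, to a point of a fixed closed ball. -/
theorem exists_congruent_mem_closedBall {L : ℝ} (hL : 0 < L) (x : Plane) :
    ∃ y ∈ Metric.closedBall (0 : Plane) (2 * L),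
      ∀ {α : Type} (F : Plane → α), SpacePeriodic L F → F x = F y := by
  have hd : x = x 0 • e 0 + x 1 • e 1 := by
    ext i; fin_cases i <;> simp [e]
  -- Both coordinates of this point lie in `[0, L)`, so the triangle inequality bounds its norm by
  -- `2 * L`.
  refine ⟨x - ⌊x 0 / L⌋ • L • e 0 - ⌊x 1 / L⌋ • L • e 1, ?_, ?_⟩
  · have hy : x - ⌊x 0 / L⌋ • L • e 0 - ⌊x 1 / L⌋ • L • e 1
        = (L * Int.fract (x 0 / L)) • e 0 + (L * Int.fract (x 1 / L)) • e 1 := by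
      have h (i : Fin 2) : L * Int.fract (x i / L) = x i - ⌊x i / L⌋ * L := by
        rw [← Int.self_sub_floor]; field_simp
      rw [h, h]
      nth_rewrite 1 [hd]
      simp only [← Int.cast_smul_eq_zsmul ℝ]
      module
    rw [hy, mem_closedBall_zero_iff]
    have hn (i : Fin 2) : ‖(L * Int.fract (x i / L)) • e i‖ ≤ L := by
      rw [norm_smul, e, PiLp.norm_single, norm_one, mul_one, Real.norm_eq_abs,
        abs_of_nonneg (mul_nonneg hL.le (Int.fract_nonneg _))]
      exact mul_le_of_le_one_right hL.le (Int.fract_lt_one _).le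
    exact (norm_add_le _ _).trans (by linarith [hn 0, hn 1])
  · intro α F hF
    have hp (i : Fin 2) : Function.Periodic F (L • e i) := hF i
    rw [((hp 1).zsmul _).sub_eq, ((hp 0).zsmul _).sub_eq]

/-- A continuous space-periodic function on a nonempty compact time interval attains its maximum. -/
theorem exists_forall_le_of_spacePeriodic {L a b : ℝ} (hL : 0 < L) (hab : a ≤ b)
    {ψ : ℝ → Plane → ℝ}
    (hc : ContinuousOn (fun z : ℝ × Plane => ψ z.1 z.2) (Icc a b ×ˢ univ))
    (hp : ∀ t ∈ Icc a b, SpacePeriodic L (ψ t)) :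
    ∃ t₀ ∈ Icc a b, ∃ x₀, ∀ t ∈ Icc a b, ∀ x, ψ t x ≤ ψ t₀ x₀ := by
  have hK : IsCompact (Icc a b ×ˢ Metric.closedBall (0 : Plane) (2 * L)) :=
    isCompact_Icc.prod (isCompact_closedBall _ _)
  obtain ⟨⟨t₀, x₀⟩, hz, hmax⟩ := hK.exists_isMaxOn
    ⟨(a, 0), ⟨le_rfl, hab⟩, Metric.mem_closedBall_self (by positivity)⟩
    (hc.mono (prod_mono_right (subset_univ _)))
  refine ⟨t₀, hz.1, x₀, fun t ht x => ?_⟩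
  obtain ⟨y, hy, hxy⟩ := exists_congruent_mem_closedBall hL x
  rw [hxy (ψ t) (hp t ht)]
  exact hmax (show (t, y) ∈ _ from ⟨ht, hy⟩)

/-! ### Maximum principle -/

/-- The second derivative of a real function is nonpositive at a local maximum. -/
theorem deriv_deriv_nonpos_of_isLocalMax {f : ℝ → ℝ} {a : ℝ} (h : IsLocalMax f a)
    (hc : ContinuousAt f a) : deriv (deriv f) a ≤ 0 := by
  by_contra! hpos
  -- A positive second derivative would also make `a` a local minimum, so `f` would be locally
  -- constant there.
  have hmin := isLocalMin_of_deriv_deriv_pos hpos h.deriv_eq_zero hc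
  have heq : f =ᶠ[nhds a] fun _ => f a := by
    filter_upwards [h, hmin] with y h₁ h₂ using le_antisymm h₁ h₂
  have h0 := heq.deriv.deriv_eq
  simp at h0
  exact hpos.ne' h0

/-- The partial derivative in the `i`-th coordinate direction. -/
noncomputable def pd (i : Fin 2) (f : Plane → ℝ) (x : Plane) : ℝ := fderiv ℝ f x (e i)

theorem fderiv_fderiv_apply {f : Plane → ℝ} (hf : ContDiff ℝ 2 f) (x : Plane) (i j : Fin 2) :
    fderiv ℝ (fderiv ℝ f) x (e i) (e j) = pd i (pd j f) x := by
  have hd : DifferentiableAt ℝ (fderiv ℝ f) x :=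
    ((hf.fderiv_right (m := 1) (by norm_num)).differentiable one_ne_zero) x
  change _ = fderiv ℝ (fun y => fderiv ℝ f y (e j)) x (e i)
  rw [fderiv_clm_apply hd (differentiableAt_const _)]
  simp

theorem laplacian_eq_pd {f : Plane → ℝ} (hf : ContDiff ℝ 2 f) (x : Plane) :
    (Δ f) x = pd 0 (pd 0 f) x + pd 1 (pd 1 f) x := by
  rw [InnerProductSpace.laplacian_eq_iteratedFDeriv_orthonormalBasis f
    (EuclideanSpace.basisFun (Fin 2) ℝ)]
  simp only [Fin.sum_univ_two, iteratedFDeriv_two_apply, EuclideanSpace.basisFun_apply]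
  rw [← fderiv_fderiv_apply hf, ← fderiv_fderiv_apply hf]
  simp [e]

theorem pd_comm {f : Plane → ℝ} (hf : ContDiff ℝ 2 f) (x : Plane) (i j : Fin 2) :
    pd i (pd j f) x = pd j (pd i f) x := by
  rw [← fderiv_fderiv_apply hf, ← fderiv_fderiv_apply hf]
  exact (hf.contDiffAt.isSymmSndFDerivAt (by simp)) _ _

/-- Restriction to the line `x + r • e i` reduces this to one variable. -/
theorem pd_pd_nonpos_of_isLocalMax {f : Plane → ℝ} (hf : ContDiff ℝ 2 f) {x : Plane}
    (h : IsLocalMax f x) (i : Fin 2) : pd i (pd i f) x ≤ 0 := by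
  have hl (s : ℝ) : HasDerivAt (fun r : ℝ => x + r • e i) (e i) s := by
    simpa using ((hasDerivAt_id s).smul_const (e i)).const_add x
  have hline {g : Plane → ℝ} (hg : Differentiable ℝ g) (s : ℝ) :
      deriv (fun r : ℝ => g (x + r • e i)) s = pd i g (x + s • e i) :=
    ((hg _).hasFDerivAt.comp_hasDerivAt s (hl s)).deriv
  have hd : Differentiable ℝ f := hf.differentiable two_ne_zero
  have hd1 : Differentiable ℝ (pd i f) :=
    ((hf.fderiv_right (m := 1) (by norm_num)).differentiable one_ne_zero).clm_apply
      (differentiable_const _)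
  have hcont : Continuous fun r : ℝ => x + r • e i := by fun_prop
  have hmax : IsLocalMax (fun r : ℝ => f (x + r • e i)) 0 := by
    refine IsLocalMax.comp_continuous (g := fun r : ℝ => x + r • e i) (f := f) ?_ hcont.continuousAt
    simpa using h
  have key := deriv_deriv_nonpos_of_isLocalMax hmax (hd.continuous.comp hcont).continuousAt
  rw [show deriv (fun r : ℝ => f (x + r • e i)) = fun s => pd i f (x + s • e i) from
    funext (hline hd), hline hd1] at key
  simpa using key

theorem laplacian_nonpos_of_isLocalMax {f : Plane → ℝ} (hf : ContDiff ℝ 2 f) {x : Plane}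
    (h : IsLocalMax f x) : (Δ f) x ≤ 0 := by
  rw [laplacian_eq_pd hf]
  exact add_nonpos (pd_pd_nonpos_of_isLocalMax hf h 0) (pd_pd_nonpos_of_isLocalMax hf h 1)

/-- The maximum principle for strict subsolutions of a backward parabolic equation. -/
theorem nonpos_of_strict_subsolution {L a b c : ℝ} (hL : 0 < L) (hc : 0 ≤ c)
    {ψ ψ' : ℝ → Plane → ℝ} {v : Plane → Plane}
    (hcont : ContinuousOn (fun z : ℝ × Plane => ψ z.1 z.2) (Icc a b ×ˢ univ))
    (hper : ∀ t ∈ Icc a b, SpacePeriodic L (ψ t))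
    (hspace : ∀ t ∈ Ico a b, ContDiff ℝ 2 (ψ t))
    (htime : ∀ t ∈ Ico a b, ∀ x, HasDerivAt (fun s => ψ s x) (ψ' t x) t)
    (hsub : ∀ t ∈ Ico a b, ∀ x, 0 < ψ' t x - fderiv ℝ (ψ t) x (v x) + c * (Δ (ψ t)) x)
    (hend : ∀ x, ψ b x ≤ 0) {t : ℝ} (ht : t ∈ Icc a b) (x : Plane) : ψ t x ≤ 0 := by
  obtain ⟨t₀, ht₀, x₀, hmax⟩ := exists_forall_le_of_spacePeriodic hL (ht.1.trans ht.2) hcont hper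
  refine (hmax t ht x).trans ?_
  rcases ht₀.2.eq_or_lt with rfl | hlt
  · exact hend x₀
  exfalso
  have hm : t₀ ∈ Ico a b := ⟨ht₀.1, hlt⟩
  have hloc : IsLocalMax (ψ t₀) x₀ := Filter.Eventually.of_forall (hmax t₀ ht₀)
  have hlap := mul_nonpos_of_nonneg_of_nonpos hc (laplacian_nonpos_of_isLocalMax (hspace t₀ hm) hloc)
  have hpos : 0 < ψ' t₀ x₀ := by
    have := hsub t₀ hm x₀
    rw [hloc.fderiv_eq_zero] at this
    simp only [zero_apply, sub_zero] at this
    linarith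
  -- A positive time derivative makes `ψ` exceed its maximum at slightly later times. Only later
  -- times are used, so `t₀ = a` needs no separate case.
  have hgt : ∀ᶠ s in nhdsWithin t₀ (Ioi t₀), ψ t₀ x₀ < ψ s x₀ := by
    have hs := (hasDerivWithinAt_iff_tendsto_slope' (by simp)).1
      ((htime t₀ hm x₀).hasDerivWithinAt (s := Ioi t₀))
    filter_upwards [hs.eventually (lt_mem_nhds hpos), self_mem_nhdsWithin] with s h₁ h₂
    rw [slope_def_field] at h₁
    have := (div_pos_iff_of_pos_right (sub_pos.2 h₂)).1 h₁
    linarith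
  obtain ⟨s, h₁, h₂⟩ := (hgt.and (Ioo_mem_nhdsGT hlt)).exists
  exact (hmax s ⟨ht₀.1.trans h₂.1.le, h₂.2.le⟩ x₀).not_gt h₁

/-! ### Coordinate calculus and the curl of the momentum equation -/

theorem _root_.ContDiff.pd {m n : WithTop ℕ∞} {f : Plane → ℝ} (hf : ContDiff ℝ n f)
    (hmn : m + 1 ≤ n) (i : Fin 2) : ContDiff ℝ m (pd i f) :=
  (hf.fderiv_right hmn).clm_apply contDiff_const

theorem pd_add {f g : Plane → ℝ} {x : Plane} (hf : DifferentiableAt ℝ f x)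
    (hg : DifferentiableAt ℝ g x) (i : Fin 2) :
    pd i (fun y => f y + g y) x = pd i f x + pd i g x := by
  simp only [pd]; rw [fderiv_fun_add hf hg]; rfl

theorem pd_sub {f g : Plane → ℝ} {x : Plane} (hf : DifferentiableAt ℝ f x)
    (hg : DifferentiableAt ℝ g x) (i : Fin 2) :
    pd i (fun y => f y - g y) x = pd i f x - pd i g x := by
  simp only [pd]; rw [fderiv_fun_sub hf hg]; rfl

theorem pd_mul {f g : Plane → ℝ} {x : Plane} (hf : DifferentiableAt ℝ f x)
    (hg : DifferentiableAt ℝ g x) (i : Fin 2) :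
    pd i (fun y => f y * g y) x = f x * pd i g x + g x * pd i f x := by
  simp only [pd]; rw [fderiv_fun_mul hf hg]; rfl

theorem pd_const_mul {f : Plane → ℝ} {x : Plane} (hf : DifferentiableAt ℝ f x) (c : ℝ)
    (i : Fin 2) : pd i (fun y => c * f y) x = c * pd i f x := by
  simp only [pd]; rw [fderiv_const_mul hf]; rfl

theorem pd_component {v : Plane → Plane} {x : Plane} (hv : DifferentiableAt ℝ v x) (i j : Fin 2) :
    pd i (fun y => v y j) x = fderiv ℝ v x (e i) j := by
  have h := ((EuclideanSpace.proj (𝕜 := ℝ) j).hasFDerivAt.comp x hv.hasFDerivAt).fderiv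
  exact congrArg (fun l : Plane →L[ℝ] ℝ => l (e i)) h

theorem curl_eq_pd {v : Plane → Plane} {x : Plane} (hv : DifferentiableAt ℝ v x) :
    curl v x = pd 0 (fun y => v y 1) x - pd 1 (fun y => v y 0) x := by
  rw [pd_component hv, pd_component hv]; rfl

theorem fderiv_apply_eq_sum {f : Plane → ℝ} (x y : Plane) :
    fderiv ℝ f x y = y 0 * pd 0 f x + y 1 * pd 1 f x := by
  have hd : y = y 0 • e 0 + y 1 • e 1 := by
    ext i; fin_cases i <;> simp [e]
  nth_rewrite 1 [hd]
  simp [pd]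

theorem gradient_component (q : Plane → ℝ) (x : Plane) (i : Fin 2) :
    (∇ q) x i = pd i q x := by
  have h := inner_gradient_left (𝕜 := ℝ) (f := q) (x := x) (y := e i)
  rw [pd, ← h]
  simp [e, EuclideanSpace.inner_single_right, -inner_gradient_left]

theorem laplacian_component {v : Plane → Plane} (hv : ContDiff ℝ 2 v) (x : Plane) (j : Fin 2) :
    (Δ v) x j = (Δ fun y => v y j) x :=
  (hv.contDiffAt.laplacian_CLM_comp_left (l := EuclideanSpace.proj (𝕜 := ℝ) j)).symm

theorem contDiff_component {n : WithTop ℕ∞} {v : Plane → Plane} (hv : ContDiff ℝ n v) (j : Fin 2) :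
    ContDiff ℝ n fun y => v y j :=
  (EuclideanSpace.proj (𝕜 := ℝ) j).contDiff.comp hv

/-- The Laplacian commutes with partial derivatives. -/
theorem pd_laplacian {f : Plane → ℝ} (hf : ContDiff ℝ 3 f) (i : Fin 2) (x : Plane) :
    pd i (Δ f) x = (Δ (pd i f)) x := by
  have hf2 : ContDiff ℝ 2 f := hf.of_le (by norm_num)
  have h1 (j) : ContDiff ℝ 2 (pd j f) := hf.pd (by norm_num) j
  have h2 (j k) : DifferentiableAt ℝ (pd j (pd k f)) x :=
    (((h1 k).pd (m := 1) (by norm_num) j).differentiable one_ne_zero) x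
  have hc (j k) : pd j (pd k f) = pd k (pd j f) := funext fun y => pd_comm hf2 y j k
  rw [show Δ f = _ from funext (laplacian_eq_pd hf2), pd_add (h2 _ _) (h2 _ _),
    laplacian_eq_pd (h1 i), pd_comm (h1 0), pd_comm (h1 1), hc i 0, hc i 1]

/-- The curl of the momentum equation of a planar incompressible fluid at a fixed time. -/
theorem curl_momentum {c : ℝ} {q : Plane → ℝ} {u V F : Plane → Plane} (hu : ContDiff ℝ 3 u)
    (hq : ContDiff ℝ 2 q) (hV : Differentiable ℝ V) (hF : Differentiable ℝ F)
    (hdiv : ∀ x, divergence u x = 0)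
    (hmom : ∀ x, V x + c • (Δ u) x - fderiv ℝ u x (u x) - (∇ q) x + F x = 0) (x : Plane) :
    curl V x - fderiv ℝ (curl u) x (u x) + c * (Δ (curl u)) x + curl F x = 0 := by
  have hu2 : ContDiff ℝ 2 u := hu.of_le (by norm_num)
  have hud : Differentiable ℝ u := hu.differentiable three_ne_zero
  have hc (j) : ContDiff ℝ 3 fun y => u y j := contDiff_component hu j
  have hcd (j) : DifferentiableAt ℝ (fun y => u y j) x :=
    ((hc j).differentiable three_ne_zero) x
  have hp (i j) : ContDiff ℝ 2 (pd i fun y => u y j) := (hc j).pd (by norm_num) i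
  have hpd (i j) : DifferentiableAt ℝ (pd i fun y => u y j) x :=
    ((hp i j).differentiable two_ne_zero) x
  have hlap (j) : DifferentiableAt ℝ (Δ fun y => u y j) x := by
    rw [show (Δ fun y => u y j) = _ from funext (laplacian_eq_pd ((hc j).of_le (by norm_num)))]
    have h (i) := (((hp i j).pd (m := 1) (by norm_num) i).differentiable one_ne_zero) x
    exact (h 0).add (h 1)
  have hqd (i) : DifferentiableAt ℝ (pd i q) x :=
    ((hq.pd (m := 1) (by norm_num) i).differentiable one_ne_zero) x
  have hVd (j) : DifferentiableAt ℝ (fun y => V y j) x :=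
    ((EuclideanSpace.proj (𝕜 := ℝ) j).differentiable.comp hV) x
  -- The momentum equation is solved for `F`, so that `curl F` can be expanded by the product rule.
  have hcomp (j : Fin 2) : (fun y => F y j) = fun y =>
      ((u y 0 * pd 0 (fun z => u z j) y + u y 1 * pd 1 (fun z => u z j) y) + pd j q y)
        - (V y j + c * (Δ fun z => u z j) y) := by
    funext y
    have h := congrArg (fun z : Plane => z j) (hmom y)
    have hconv : fderiv ℝ u y (u y) j
        = u y 0 * pd 0 (fun z => u z j) y + u y 1 * pd 1 (fun z => u z j) y := by
      rw [← fderiv_apply_eq_sum]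
      exact (congrArg (fun l : Plane →L[ℝ] ℝ => l (u y))
        ((EuclideanSpace.proj (𝕜 := ℝ) j).hasFDerivAt.comp y (hud y).hasFDerivAt).fderiv).symm
    simp only [PiLp.add_apply, PiLp.sub_apply, PiLp.smul_apply, PiLp.zero_apply, smul_eq_mul,
      gradient_component, laplacian_component hu2, hconv] at h
    linarith
  have hconvd (j) : DifferentiableAt ℝ (fun y =>
      u y 0 * pd 0 (fun z => u z j) y + u y 1 * pd 1 (fun z => u z j) y) x :=
    ((hcd 0).fun_mul (hpd 0 j)).fun_add ((hcd 1).fun_mul (hpd 1 j))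
  have hFpd (i j : Fin 2) : pd i (fun y => F y j) x =
      u x 0 * pd i (pd 0 fun z => u z j) x + pd 0 (fun z => u z j) x * pd i (fun z => u z 0) x
      + (u x 1 * pd i (pd 1 fun z => u z j) x + pd 1 (fun z => u z j) x * pd i (fun z => u z 1) x)
      + pd i (pd j q) x - (pd i (fun z => V z j) x + c * (Δ (pd i fun z => u z j)) x) := by
    rw [hcomp, pd_sub ((hconvd j).fun_add (hqd j)) ((hVd j).fun_add ((hlap j).const_mul c)),
      pd_add (hconvd j) (hqd j), pd_add ((hcd 0).fun_mul (hpd 0 j)) ((hcd 1).fun_mul (hpd 1 j)),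
      pd_mul (hcd 0) (hpd 0 j), pd_mul (hcd 1) (hpd 1 j), pd_add (hVd j) ((hlap j).const_mul c),
      pd_const_mul (hlap j), pd_laplacian (hc j)]
  have hcurl : curl u = fun y => pd 0 (fun z => u z 1) y - pd 1 (fun z => u z 0) y :=
    funext fun y => curl_eq_pd (hud y)
  have hlapc : (Δ (curl u)) x = (Δ (pd 0 fun z => u z 1)) x - (Δ (pd 1 fun z => u z 0)) x := by
    rw [hcurl]
    exact (hp 0 1).contDiffAt.laplacian_sub (hp 1 0).contDiffAt
  have hd := hdiv x
  rw [divergence, Fin.sum_univ_two, ← pd_component (hud x), ← pd_component (hud x)] at hd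
  rw [fderiv_apply_eq_sum, hlapc, curl_eq_pd (hV x), curl_eq_pd (hF x), hFpd, hFpd, hcurl,
    pd_sub (hpd _ _) (hpd _ _), pd_sub (hpd _ _) (hpd _ _), pd_comm hq x 1 0,
    pd_comm ((hc 1).of_le (by norm_num)) x 1 0, pd_comm ((hc 0).of_le (by norm_num)) x 1 0]
  -- By symmetry of second derivatives the pressure drops out; what remains of the convective term
  -- is ω times the divergence.
  linear_combination (pd 0 (fun z => u z 1) x - pd 1 (fun z => u z 0) x) * hd

/-! ### Space-time regularity and the vorticity equation -/

theorem _root_.ContDiffOn.contDiff_slice {E : Type*} [NormedAddCommGroup E] [NormedSpace ℝ E]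
    {n : WithTop ℕ∞} {I : Set ℝ} {F : ℝ × Plane → E} (hF : ContDiffOn ℝ n F (I ×ˢ univ)) {t : ℝ}
    (ht : t ∈ I) : ContDiff ℝ n fun x => F (t, x) := by
  rw [← contDiffOn_univ]
  exact hF.comp (g := F) (f := fun x : Plane => (t, x)) (contDiff_prodMk_right t).contDiffOn
    fun x _ => ⟨ht, mem_univ _⟩

/-- The derivative within the slab makes sense at the end times too, which gives regularity of the
vorticity up to the boundary. -/
theorem fderiv_slice {E : Type*} [NormedAddCommGroup E] [NormedSpace ℝ E] {I : Set ℝ}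
    {F : ℝ × Plane → E} (hF : DifferentiableOn ℝ F (I ×ˢ univ)) {t : ℝ} (ht : t ∈ I) (x y : Plane) :
    fderiv ℝ (fun x => F (t, x)) x y = fderivWithin ℝ F (I ×ˢ univ) (t, x) (0, y) := by
  have h := ((hF (t, x) ⟨ht, mem_univ _⟩).hasFDerivWithinAt.comp x
    ((hasFDerivAt_prodMk_right t x).hasFDerivWithinAt (s := univ))
    fun z _ => ⟨ht, mem_univ _⟩)
  rw [hasFDerivWithinAt_univ] at h
  exact congrArg (fun l : Plane →L[ℝ] E => l y) h.fderiv

theorem SpacePeriodic.curl {L : ℝ} {v : Plane → Plane} (hv : SpacePeriodic L v) :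
    SpacePeriodic L (curl v) := by
  intro i x
  have h : fderiv ℝ v (x + L • e i) = fderiv ℝ v x := by
    rw [← fderiv_comp_add_right]
    simp only [hv i]
  simp only [NSVorticity.curl, h]

theorem contDiffOn_curl {T : ℝ} (hT : 0 < T) {u : ℝ → Plane → Plane}
    (hu : ContDiffOn ℝ 3 (fun z : ℝ × Plane => u z.1 z.2) (Icc 0 T ×ˢ univ)) :
    ContDiffOn ℝ 2 (fun z : ℝ × Plane => curl (u z.1) z.2) (Icc 0 T ×ˢ univ) := by
  set S : Set (ℝ × Plane) := Icc 0 T ×ˢ univ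
  have hS : UniqueDiffOn ℝ S := (uniqueDiffOn_Icc hT).prod uniqueDiffOn_univ
  have hD := hu.fderivWithin hS (m := 2) (by norm_num)
  have hc (i j : Fin 2) : ContDiffOn ℝ 2
      (fun z => fderivWithin ℝ (fun z : ℝ × Plane => u z.1 z.2) S z (0, e i) j) S :=
    (EuclideanSpace.proj (𝕜 := ℝ) j).contDiff.comp_contDiffOn
      (hD.clm_apply contDiffOn_const)
  refine ((hc 0 1).sub (hc 1 0)).congr fun z hz => ?_
  have h (y : Plane) := fderiv_slice (hu.differentiableOn three_ne_zero) hz.1 z.2 y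
  simp only [curl]
  exact congrArg₂ (· - ·) (congrArg (fun v : Plane => v 1) (h (e 0)))
    (congrArg (fun v : Plane => v 0) (h (e 1)))

theorem differentiableAt_fderiv_slice {E F : Type*} [NormedAddCommGroup E] [NormedSpace ℝ E]
    [NormedAddCommGroup F] [NormedSpace ℝ F] {U : ℝ × E → F} {t : ℝ} {x : E}
    (hU : ContDiffAt ℝ 2 U (t, x)) :
    DifferentiableAt ℝ (fun y => fderiv ℝ U (t, y) (1, 0)) x := by
  have hD : DifferentiableAt ℝ (fderiv ℝ U) (t, x) :=
    (hU.fderiv_right (m := 1) (by norm_num)).differentiableAt one_ne_zero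
  exact (hD.comp x (hasFDerivAt_prodMk_right t x).differentiableAt).clm_apply
    (differentiableAt_const _)

/-- The time derivative commutes with spatial derivatives. -/
theorem hasDerivAt_fderiv_slice {E F : Type*} [NormedAddCommGroup E] [NormedSpace ℝ E]
    [NormedAddCommGroup F] [NormedSpace ℝ F] {U : ℝ × E → F} {t : ℝ} {x : E}
    (hU : ContDiffAt ℝ 2 U (t, x)) (z : E) :
    HasDerivAt (fun s => fderiv ℝ U (s, x) (0, z))
      (fderiv ℝ (fun y => fderiv ℝ U (t, y) (1, 0)) x z) t := by
  have hD : DifferentiableAt ℝ (fderiv ℝ U) (t, x) :=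
    (hU.fderiv_right (m := 1) (by norm_num)).differentiableAt one_ne_zero
  have h1 : HasFDerivAt (fun y => fderiv ℝ U (t, y))
      ((fderiv ℝ (fderiv ℝ U) (t, x)).comp (ContinuousLinearMap.inr ℝ ℝ E)) x :=
    hD.hasFDerivAt.comp x (hasFDerivAt_prodMk_right t x)
  have h2 : HasDerivAt (fun s => fderiv ℝ U (s, x)) (fderiv ℝ (fderiv ℝ U) (t, x) (1, 0)) t :=
    hD.hasFDerivAt.comp_hasDerivAt t ((hasDerivAt_id t).prodMk (hasDerivAt_const t x))
  have h3 := h2.clm_apply (hasDerivAt_const t ((0, z) : ℝ × E))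
  rw [map_zero, add_zero, (hU.isSymmSndFDerivAt (by simp)).eq (1, 0) (0, z)] at h3
  rw [fderiv_clm_apply h1.differentiableAt (differentiableAt_const _), h1.fderiv]
  simpa using h3

/-- The vorticity of a classical solution satisfies the vorticity equation. -/
theorem IsNavierStokesSolution.vorticity_equation {L σ T : ℝ} {f : ℝ → Plane → Plane}
    {φ : Plane → Plane} {u : ℝ → Plane → Plane} {p : ℝ → Plane → ℝ}
    (hu : IsNavierStokesSolution L σ T f φ u p) {t : ℝ} (ht : t ∈ Ioo 0 T) (x : Plane) :
    HasDerivAt (fun s => curl (u s) x) (fderiv ℝ (curl (u t)) x (u t x)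
      - σ ^ 2 / 2 * (Δ (curl (u t))) x - curl (f t) x) t := by
  set U : ℝ × Plane → Plane := fun z => u z.1 z.2 with hU
  have hO : IsOpen (Ioo 0 T ×ˢ univ : Set (ℝ × Plane)) := isOpen_Ioo.prod isOpen_univ
  have hUo : ContDiffOn ℝ 3 U (Ioo 0 T ×ˢ univ) :=
    hu.smooth_velocity.mono (prod_mono_left Ioo_subset_Icc_self)
  have hat {s : ℝ} (hs : s ∈ Ioo 0 T) (y : Plane) : ContDiffAt ℝ 3 U (s, y) :=
    hUo.contDiffAt (hO.mem_nhds ⟨hs, mem_univ _⟩)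
  have hdU {s : ℝ} (hs : s ∈ Ioo 0 T) (y : Plane) : DifferentiableAt ℝ U (s, y) :=
    (hat hs y).differentiableAt three_ne_zero
  have hspace {s : ℝ} (hs : s ∈ Ioo 0 T) (y z : Plane) :
      fderiv ℝ (u s) y z = fderiv ℝ U (s, y) (0, z) :=
    (fderiv_slice (hUo.differentiableOn three_ne_zero) hs y z).trans
      (by rw [fderivWithin_of_isOpen hO ⟨hs, mem_univ _⟩])
  have hline (s : ℝ) (y : Plane) : HasDerivAt (fun r : ℝ => (r, y)) ((1, 0) : ℝ × Plane) s :=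
    (hasDerivAt_id s).prodMk (hasDerivAt_const s y)
  set V : Plane → Plane := fun y => fderiv ℝ U (t, y) (1, 0) with hV
  have hVt (y : Plane) : derivWithin (fun s => u s y) (Icc 0 T) t = V y := by
    rw [derivWithin_of_mem_nhds (Icc_mem_nhds ht.1 ht.2)]
    exact ((hdU ht y).hasFDerivAt.comp_hasDerivAt t (hline t y)).deriv
  have hat2 (y : Plane) : ContDiffAt ℝ 2 U (t, y) := (hat ht y).of_le (by norm_num)
  have htime (i j : Fin 2) : HasDerivAt (fun s => fderiv ℝ (u s) x (e i) j)
      (fderiv ℝ V x (e i) j) t := by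
    have h := (EuclideanSpace.proj (𝕜 := ℝ) j).hasFDerivAt.comp_hasDerivAt t
      (hasDerivAt_fderiv_slice (hat2 x) (e i))
    refine h.congr_of_eventuallyEq ?_
    filter_upwards [Ioo_mem_nhds ht.1 ht.2] with s hs
    rw [hspace hs]; rfl
  have hm : t ∈ Ico 0 T := ⟨ht.1.le, ht.2⟩
  have hc : t ∈ Icc 0 T := ⟨ht.1.le, ht.2.le⟩
  have key := curl_momentum (V := V) (c := σ ^ 2 / 2) (hu.smooth_velocity.contDiff_slice hc)
    (hu.smooth_pressure t hm) (fun y => differentiableAt_fderiv_slice (hat2 y))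
    ((hu.smooth_force t hm).differentiable one_ne_zero) (hu.incompressible t hc)
    (fun y => hVt y ▸ hu.momentum t hm y) x
  exact ((htime 0 1).sub (htime 1 0)).congr_deriv (by rw [curl] at key; linarith)

/-! ### Uniform bounds and the one-step error -/

/-- A `C¹` space-periodic function is Lipschitz in time and has bounded spatial derivatives. -/
theorem exists_lipschitz_bound_of_spacePeriodic {L a b : ℝ} (hL : 0 < L) {E : Type}
    [NormedAddCommGroup E] [NormedSpace ℝ E] {F : ℝ → Plane → E}
    (hF : ContDiffOn ℝ 1 (fun z : ℝ × Plane => F z.1 z.2) (Icc a b ×ˢ univ))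
    (hp : ∀ t ∈ Icc a b, SpacePeriodic L (F t)) :
    ∃ C : ℝ, 0 ≤ C ∧ (∀ s ∈ Icc a b, ∀ t ∈ Icc a b, ∀ x, ‖F s x - F t x‖ ≤ C * |s - t|) ∧
      ∀ t ∈ Icc a b, ∀ x, ‖fderiv ℝ (F t) x‖ ≤ C := by
  -- The extra 1 makes `B` a neighbourhood of every representative point, so its Lipschitz constant
  -- bounds the derivative there.
  set B : Set Plane := Metric.closedBall 0 (2 * L + 1)
  obtain ⟨K, hK⟩ := (hF.mono (prod_mono_right (subset_univ B))).exists_lipschitzOnWith one_ne_zero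
    ((convex_Icc a b).prod (convex_closedBall _ _)) (isCompact_Icc.prod (isCompact_closedBall _ _))
  have hsub : Metric.closedBall (0 : Plane) (2 * L) ⊆ B :=
    Metric.closedBall_subset_closedBall (by linarith)
  refine ⟨K, K.2, fun s hs t ht x => ?_, fun t ht x => ?_⟩
  · obtain ⟨y, hy, hxy⟩ := exists_congruent_mem_closedBall hL x
    rw [hxy _ (hp s hs), hxy _ (hp t ht)]
    have h := hK.dist_le_mul (s, y) ⟨hs, hsub hy⟩ (t, y) ⟨ht, hsub hy⟩
    simpa [dist_eq_norm, Prod.norm_def] using h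
  · obtain ⟨y, hy, hxy⟩ := exists_congruent_mem_closedBall hL x
    have hper : SpacePeriodic L (fderiv ℝ (F t)) := fun i z => by
      rw [← fderiv_comp_add_right]
      simp only [hp t ht i]
    rw [hxy _ hper]
    have hB : B ∈ nhds y := by
      refine Metric.closedBall_mem_nhds_of_mem ?_
      rw [Metric.mem_closedBall] at hy
      rw [Metric.mem_ball]
      linarith
    refine norm_fderiv_le_of_lipschitzOn ℝ hB (LipschitzOnWith.of_dist_le_mul fun z hz z' hz' => ?_)
    have h := hK.dist_le_mul (t, z) ⟨ht, hz⟩ (t, z') ⟨ht, hz'⟩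
    simpa [Prod.dist_eq] using h

/-- A subsolution with zero terminal value and small right-hand side is small. -/
theorem le_mul_of_subsolution {L a b c M : ℝ} (hL : 0 < L) (hab : a < b) (hc : 0 ≤ c)
    {δ δ' : ℝ → Plane → ℝ} {v : Plane → Plane}
    (hcont : ContinuousOn (fun z : ℝ × Plane => δ z.1 z.2) (Icc a b ×ˢ univ))
    (hper : ∀ t ∈ Icc a b, SpacePeriodic L (δ t))
    (hspace : ∀ t ∈ Ioo a b, ContDiff ℝ 2 (δ t))
    (htime : ∀ t ∈ Ioo a b, ∀ x, HasDerivAt (fun s => δ s x) (δ' t x) t)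
    (hsub : ∀ t ∈ Ioo a b, ∀ x, -M < δ' t x - fderiv ℝ (δ t) x (v x) + c * (Δ (δ t)) x)
    (hend : ∀ x, δ b x ≤ 0) {t : ℝ} (ht : t ∈ Icc a b) (x : Plane) : δ t x ≤ M * (b - t) := by
  have hclosure : closure (Ioc a b) = Icc a b := closure_Ioc hab.ne
  -- The equation is assumed only for times in the open interval: the bound is proved at each `s >
  -- a` and extended to `a` by continuity.
  refine le_on_closure (s := Ioc a b) (f := fun t => δ t x) (g := fun t => M * (b - t)) ?_ ?_
    (by fun_prop) (hclosure ▸ ht)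
  swap
  · rw [hclosure]
    exact hcont.comp (f := fun t : ℝ => (t, x)) (by fun_prop) fun s hs => ⟨hs, mem_univ _⟩
  intro s hs
  have hsubset : Icc s b ⊆ Icc a b := Icc_subset_Icc_left hs.1.le
  have hio {r : ℝ} (hr : r ∈ Ico s b) : r ∈ Ioo a b := ⟨hs.1.trans_le hr.1, hr.2⟩
  -- The barrier `M * (b - t)` vanishes at `b`; subtracting it adds `M` to the time derivative,
  -- which makes the subsolution strict.
  have key := nonpos_of_strict_subsolution (ψ := fun t x => δ t x - M * (b - t))
    (ψ' := fun t x => δ' t x + M) (v := v) (a := s) (b := b) hL hc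
    ((hcont.mono (prod_mono_left hsubset)).sub (by fun_prop))
    (fun r hr i y => by simp only [hper r (hsubset hr) i y])
    (fun r hr => (hspace r (hio hr)).sub contDiff_const)
    (fun r hr y => ((htime r (hio hr) y).sub
      (((hasDerivAt_id r).const_sub b).const_mul M)).congr_deriv (by ring))
    (fun r hr y => ?_) (fun y => by simpa using hend y) (left_mem_Icc.2 hs.2) x
  · exact sub_nonpos.1 key
  · have hlap : (Δ fun z => δ r z - M * (b - r)) y = (Δ (δ r)) y := by
      have h := (hspace r (hio hr)).contDiffAt.laplacian_sub (x := y)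
        (contDiffAt_const (c := M * (b - r)))
      refine h.trans ?_
      simp
    rw [hlap, fderiv_sub_const]
    linarith [hsub r (hio hr) y]

theorem abs_le_mul_of_abs_residual_lt {L a b c M : ℝ} (hL : 0 < L) (hab : a < b) (hc : 0 ≤ c)
    {δ δ' : ℝ → Plane → ℝ} {v : Plane → Plane}
    (hcont : ContinuousOn (fun z : ℝ × Plane => δ z.1 z.2) (Icc a b ×ˢ univ))
    (hper : ∀ t ∈ Icc a b, SpacePeriodic L (δ t))
    (hspace : ∀ t ∈ Ioo a b, ContDiff ℝ 2 (δ t))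
    (htime : ∀ t ∈ Ioo a b, ∀ x, HasDerivAt (fun s => δ s x) (δ' t x) t)
    (hres : ∀ t ∈ Ioo a b, ∀ x, |δ' t x - fderiv ℝ (δ t) x (v x) + c * (Δ (δ t)) x| < M)
    (hend : ∀ x, δ b x = 0) {t : ℝ} (ht : t ∈ Icc a b) (x : Plane) : |δ t x| ≤ M * (b - t) := by
  refine abs_le'.2 ⟨?_, ?_⟩
  · exact le_mul_of_subsolution hL hab hc hcont hper hspace htime
      (fun r hr y => (abs_lt.1 (hres r hr y)).1) (fun y => (hend y).le) ht x
  · refine le_mul_of_subsolution (δ := fun t x => -δ t x) (δ' := fun t x => -δ' t x) (v := v)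
      hL hab hc hcont.neg (fun r hr i y => by simp only [hper r hr i y])
      (fun r hr => (hspace r hr).neg) (fun r hr y => (htime r hr y).neg)
      (fun r hr y => ?_) (fun y => by simp [hend y]) ht x
    have hlap : (Δ fun z => -δ r z) y = -(Δ (δ r)) y :=
      congrFun (InnerProductSpace.laplacian_neg (f := δ r)) y
    rw [hlap, fderiv_fun_neg]
    simp only [neg_apply]
    linarith [(abs_lt.1 (hres r hr y)).2]

/-- The error of freezing the velocity of a smooth flow over a subinterval `[a, b]`. -/
theorem IsNavierStokesSolution.exists_frozen_error_bound {L σ T : ℝ} (hL : 0 < L) (hT : 0 < T)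
    {f : ℝ → Plane → Plane} {φ : Plane → Plane} {u : ℝ → Plane → Plane} {p : ℝ → Plane → ℝ}
    (hu : IsNavierStokesSolution L σ T f φ u p) :
    ∃ K : ℝ, 0 < K ∧ ∀ a b : ℝ, 0 ≤ a → a < b → b ≤ T → ∀ w : ℝ → Plane → ℝ,
      IsFrozenVorticitySolution L σ a b (u b) (fun t => curl (f t)) (curl (u b)) w →
        ∀ t ∈ Icc a b, ∀ x, |curl (u t) x - w t x| ≤ K * (b - a) ^ 2 := by
  have hω := contDiffOn_curl hT hu.smooth_velocity
  have hωper : ∀ t ∈ Icc 0 T, SpacePeriodic L (curl (u t)) :=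
    fun t ht => (hu.periodic_velocity t ht).curl
  obtain ⟨C₁, hC₁, hlip, -⟩ := exists_lipschitz_bound_of_spacePeriodic hL
    (hu.smooth_velocity.of_le (by norm_num)) hu.periodic_velocity
  obtain ⟨C₂, hC₂, -, hgrad⟩ := exists_lipschitz_bound_of_spacePeriodic hL
    (F := fun t => curl (u t)) (hω.of_le (by norm_num)) hωper
  -- The `+ 1` makes `K` positive and the residual bound strict.
  refine ⟨C₁ * C₂ + 1, by positivity, fun a b ha hab hb w hw t ht x => ?_⟩
  have hsub : Icc a b ⊆ Icc 0 T := Icc_subset_Icc ha hb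
  have hioo : Ioo a b ⊆ Ioo 0 T := Ioo_subset_Ioo ha hb
  have hbm : b ∈ Icc 0 T := hsub (right_mem_Icc.2 hab.le)
  have hωC {r : ℝ} (hr : r ∈ Icc 0 T) : ContDiff ℝ 2 (curl (u r)) := hω.contDiff_slice hr
  have hpos : 0 < b - a := sub_pos.2 hab
  have key : |curl (u t) x - w t x| ≤ (C₁ * C₂ + 1) * (b - a) * (b - t) := by
    refine abs_le_mul_of_abs_residual_lt (δ := fun t x => curl (u t) x - w t x)
      (δ' := fun t x => fderiv ℝ (curl (u t)) x (u t x)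
        - σ ^ 2 / 2 * (Δ (curl (u t))) x - curl (f t) x - derivWithin (fun s => w s x) (Icc a b) t)
      (v := u b) (c := σ ^ 2 / 2) hL hab (by positivity)
      ((hω.continuousOn.mono (prod_mono_left hsub)).sub hw.continuous_upto)
      (fun r hr i y => by simp only [hωper r (hsub hr) i y, hw.periodic r hr i y])
      (fun r hr => (hωC (hsub (Ioo_subset_Icc_self hr))).sub
        (hw.smooth_space r (Ioo_subset_Ico_self hr)))
      (fun r hr y => (hu.vorticity_equation (hioo hr) y).sub
        ((hw.smooth_time r (Ioo_subset_Ico_self hr) y).hasDerivWithinAt.hasDerivAt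
          (Icc_mem_nhds hr.1 hr.2)))
      (fun r hr y => ?_) (fun y => sub_eq_zero.2 (hw.terminal y).symm) ht x
    have hrT := hsub (Ioo_subset_Icc_self hr)
    have hωr := hωC hrT
    have hwr := hw.smooth_space r (Ioo_subset_Ico_self hr)
    have hlap : (Δ fun z => curl (u r) z - w r z) y = (Δ (curl (u r))) y - (Δ (w r)) y :=
      hωr.contDiffAt.laplacian_sub hwr.contDiffAt
    rw [hlap, fderiv_fun_sub (hωr.differentiable two_ne_zero y) (hwr.differentiable two_ne_zero y)]
    have heq := hw.equation r (Ioo_subset_Ico_self hr) y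
    -- The force, the Laplacians and the derivatives of `w` cancel; only the velocity increment
    -- acting on ∇ω survives.
    have hres : fderiv ℝ (curl (u r)) y (u r y) - σ ^ 2 / 2 * (Δ (curl (u r))) y - curl (f r) y
        - derivWithin (fun s => w s y) (Icc a b) r
        - (fderiv ℝ (curl (u r)) y - fderiv ℝ (w r) y) (u b y)
        + σ ^ 2 / 2 * ((Δ (curl (u r))) y - (Δ (w r)) y)
        = fderiv ℝ (curl (u r)) y (u r y - u b y) := by
      rw [map_sub, sub_apply]
      linarith
    rw [hres, ← Real.norm_eq_abs]
    have hrb : |r - b| ≤ b - a := by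
      rw [abs_sub_comm, abs_of_pos (sub_pos.2 hr.2)]
      linarith [hr.1]
    calc ‖fderiv ℝ (curl (u r)) y (u r y - u b y)‖
        ≤ C₂ * (C₁ * (b - a)) := by
          refine (ContinuousLinearMap.le_of_opNorm_le _ (hgrad r hrT y) _).trans ?_
          exact mul_le_mul_of_nonneg_left ((hlip r hrT b hbm y).trans
            (mul_le_mul_of_nonneg_left hrb hC₁)) hC₂
      _ < (C₁ * C₂ + 1) * (b - a) := by linarith
  refine key.trans ?_
  rw [pow_two, ← mul_assoc]
  exact mul_le_mul_of_nonneg_left (by linarith [ht.1]) (by positivity)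

end NSVorticity

theorem mainTheorem6 (L σ T : ℝ) (hL : 0 < L) (hT : 0 < T)
    (f : ℝ → NSVorticity.Plane → NSVorticity.Plane)
    (φ : NSVorticity.Plane → NSVorticity.Plane)
    (u : ℝ → NSVorticity.Plane → NSVorticity.Plane)
    (p : ℝ → NSVorticity.Plane → ℝ)
    (hu : NSVorticity.IsNavierStokesSolution L σ T f φ u p) :
    ∃ K : ℝ, 0 < K ∧ ∀ N : ℕ, 1 ≤ N → ∀ k : ℕ, k < N →
      ∀ w : ℝ → NSVorticity.Plane → ℝ,
        NSVorticity.IsFrozenVorticitySolution L σ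
          (NSVorticity.node T N k) (NSVorticity.node T N (k + 1))
          (u (NSVorticity.node T N (k + 1)))
          (fun t => NSVorticity.curl (f t))
          (NSVorticity.curl (u (NSVorticity.node T N (k + 1)))) w →
        ∀ t ∈ Set.Icc (NSVorticity.node T N k) (NSVorticity.node T N (k + 1)),
          ∀ x : NSVorticity.Plane,
            |NSVorticity.curl (u t) x - w t x| ≤ K * NSVorticity.step T N ^ 2 := by
  obtain ⟨K, hK, hbound⟩ := hu.exists_frozen_error_bound hL hT
  refine ⟨K, hK, fun N hN k hk w hw t ht x => ?_⟩
  have hN0 : (0 : ℝ) < N := by exact_mod_cast hN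
  have hstep : 0 < NSVorticity.step T N := div_pos hT hN0
  have hdiff : NSVorticity.node T N (k + 1) - NSVorticity.node T N k = NSVorticity.step T N := by
    simp only [NSVorticity.node]; push_cast; ring
  have hle : NSVorticity.node T N (k + 1) ≤ T := by
    have hkN : ((k + 1 : ℕ) : ℝ) ≤ N := by exact_mod_cast hk
    calc ((k + 1 : ℕ) : ℝ) * NSVorticity.step T N ≤ N * NSVorticity.step T N :=
          mul_le_mul_of_nonneg_right hkN hstep.le
      _ = T := mul_div_cancel₀ T hN0.ne'
  have hlt : NSVorticity.node T N k < NSVorticity.node T N (k + 1) := by linarith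
  rw [← hdiff]
  exact hbound _ _ (mul_nonneg (Nat.cast_nonneg k) hstep.le) hlt hle w hw t ht x
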